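/- Let $G=(V,E)$ be a finite connected loopless multigraph, and let $\mathbb E$ be the set of its oriented edges: each edge gives two of them, and $\overline e$ denotes the reverse of $e$. Let $C^1(G,\mathbb R)$ be the space of functions $x\colon\mathbb E\to\mathbb R$ with $x_{\overline e}=-x_e$, with the scalar product $\langle x,y\rangle=\frac12\sum_{e\in\mathbb E}x_ey_e$ (the sum over the edges of $G$, each taken with one orientation). For $f\colon V\to\mathbb R$ define $d(f)\in C^1(G,\mathbb R)$ by $d(f)_e=f(v)-f(u)$ for every oriented edge $e$ with tail $u$ and head $v$. Let $F_{\mathbb R}=\{d(f): f\colon V\to\mathbb R\}$ be the cut space, $F_{\mathbb Z}=\{d(f): f\colon V\to\mathbb Z\}$ the cut lattice, and $$\mathrm{Vor}_F(O)=\{x\in F_{\mathbb R}:\ \|x\|\le\|x-\mu\|\ \text{for all }\mu\in F_{\mathbb Z}\}$$ the cut Voronoi polytope. Let $\mathcal{FP}$ be the set of non-empty faces of $\mathrm{Vor}_F(O)$ (including $\mathrm{Vor}_F(O)$ itself), ordered by inclusion. A coherent acyclic orientation of a cut subgraph of $G$ is given by an ordered partition $V_1,\dots,V_s$ of $V$ into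 non-empty sets ($s\ge 1$): the cut subgraph is the spanning subgraph formed by the edges with ends in different parts, and each of its edges between $V_i$ and $V_j$ with $i<j$ is oriented from $V_i$ to $V_j$. It is identified with its set $\mathbb E(D)\subseteq\mathbb E$ of oriented edges. Let $\mathcal{CAC}$ be the set of all coherent acyclic orientations of cut subgraphs of $G$, ordered by $D_1\preceq D_2$ if and only if $\mathbb E(D_2)\subseteq\mathbb E(D_1)$. A bond element is an element $\beta\in F_{\mathbb Z}$ of the form $\beta=d(\chi_C)$, where $\chi_C$ is the characteristic function of a set $C\subset V$ such that $C$ and $V\setminus C$ are non-empty and induce connected subgraphs of $G$. Write $F_\beta=\{x\in F_{\mathbb R}: 2\langle x,\beta\rangle=\|\beta\|^2\}$ and, for $x\in C^1(G,\mathbb R)$, $\mathrm{supp}^+(x)=\{e\in\mathbb E: x_e>0\}$. Then the posets $\mathcal{FP}$ and $\mathcal{CAC}$ are isomorphic. More precisely, an isomorphism of posets $\phi\colon\mathcal{FP}\to\mathcal{CAC}$ is given by $$\phi(\mathfrak f)=\bigcup_{\beta\text{ a bond element},\ \mathfrak f\subseteq F_\beta}\mathrm{supp}^+(\beta).$$ 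-/

import Mathlib

open scoped Graph

namespace CutVoronoi

variable {α β : Type*}

/-- An oriented edge (arrow) of the multigraph `G`: an edge together with a choice of which of its
ends is the tail and which one is the head.  An edge of a loopless graph carries exactly two
of them. -/
@[ext]
structure OrientedEdge (G : Graph α β) where
  /-- the underlying edge -/
  edge : β
  /-- the tail -/
  tail : V(G)
  /-- the head -/
  head : V(G)
  /-- the underlying edge joins the tail and the head -/
  isLink : G.IsLink edge tail head

/-- The same edge with the reverse orientation. -/
def OrientedEdge.rev {G : Graph α β} (e : OrientedEdge G) : OrientedEdge G :=
  ⟨e.edge, e.head, e.tail, e.isLink.symm⟩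

/-- `G` is connected (and has a vertex). -/
def IsConnected (G : Graph α β) : Prop := G.toSimpleGraph.Connected

/-- For a set `C` of vertices, the induced subgraph `G[C]` is connected (and `C` is non-empty). -/
def IsConnectedOn (G : Graph α β) (C : Set V(G)) : Prop := (G.toSimpleGraph.induce C).Connected

/-! ### Cochains, the cut space and the cut lattice -/

/-- `C¹(G, A)`: the functions `x` on oriented edges with `x ē = - x e`. -/
def C1 (G : Graph α β) (A : Type*) [CommRing A] : Submodule A (OrientedEdge G → A) where
  carrier := {x | ∀ e, x e.rev = - x e}
  zero_mem' := fun _ => by simp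
  add_mem' := fun {x y} hx hy e => by
    have h₁ := hx e
    have h₂ := hy e
    simp only [Pi.add_apply, h₁, h₂]
    ring
  smul_mem' := fun c x hx e => by
    have h₁ := hx e
    simp only [Pi.smul_apply, smul_eq_mul, h₁]
    ring

/-- The coboundary `d : C⁰(G, A) → C¹(G, A)`, `d f (uv) = f v - f u`. -/
def d (G : Graph α β) (A : Type*) [CommRing A] : (V(G) → A) →ₗ[A] C1 G A where
  toFun f := ⟨fun e => f e.head - f e.tail, fun e => by simp [OrientedEdge.rev]⟩
  map_add' f g := by
    ext e
    simp only [Pi.add_apply, Submodule.coe_add]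
    ring
  map_smul' c f := by
    ext e
    simp only [Pi.smul_apply, smul_eq_mul, Submodule.coe_smul, RingHom.id_apply]
    ring

/-- The cut space `F_ℝ`, the image of `d` over the reals. -/
def cutSpace (G : Graph α β) : Submodule ℝ (C1 G ℝ) := LinearMap.range (d G ℝ)

/-- The coboundary as a map onto the cut space. -/
def toCutSpace (G : Graph α β) : (V(G) → ℝ) →ₗ[ℝ] cutSpace G := (d G ℝ).rangeRestrict

/-- The cut lattice `F_ℤ` in `F_ℝ`: the coboundaries of integer-valued functions. -/
def cutLattice (G : Graph α β) : AddSubgroup (cutSpace G) :=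
  ((toCutSpace G).toAddMonoidHom.comp ((Int.castAddHom ℝ).compLeft V(G))).range

/-- The scalar product of `C¹(G, ℝ)`.  The two orientations of an edge contribute equally, so this
is the sum of `x e * y e` over the edges, each with one orientation chosen. -/
noncomputable def pairing {G : Graph α β} (x y : C1 G ℝ) : ℝ :=
  (1 / 2 : ℝ) * ∑ᶠ e : OrientedEdge G, x.1 e * y.1 e

/-- The square `‖x‖²` of the norm of `C¹(G, ℝ)`. -/
noncomputable def normSq {G : Graph α β} (x : C1 G ℝ) : ℝ := pairing x x

/-! ### The cut Voronoi polytope and its faces -/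

/-- The Voronoi cell of `b` in `F_ℝ` with respect to the cut lattice. -/
def vorCell (G : Graph α β) (b : cutSpace G) : Set (cutSpace G) :=
  {x | ∀ μ ∈ cutLattice G, normSq ((x - b : cutSpace G) : C1 G ℝ) ≤
    normSq ((x - μ : cutSpace G) : C1 G ℝ)}

/-- The face poset of the cut Voronoi polytope `Vor_F(O)`: the non-empty faces, that is, the
non-empty sets of all points of the polytope at which a linear functional attains its maximum over
the polytope; the order is inclusion. -/
abbrev FacePoset (G : Graph α β) : Type _ :=
  {f : Set (cutSpace G) // IsExposed ℝ (vorCell G 0) f ∧ f.Nonempty}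

/-! ### Coherent acyclic orientations of cut subgraphs -/

/-- The edge set of the cut subgraph of a partition: the edges with ends in different parts.
A partition with parts `V_0, …, V_{s-1}` is given by the map taking a vertex to the index of its
part. -/
def cutEdges (G : Graph α β) {s : ℕ} (p : V(G) → Fin s) : Set β :=
  {e | ∃ u v : V(G), G.IsLink e u v ∧ p u ≠ p v}

/-- `D` is (the set of oriented edges of) an orientation of the spanning subgraph with edge
set `S`: it contains exactly one orientation of each edge of `S`, and nothing else. -/
def IsOrientation {G : Graph α β} (D : Set (OrientedEdge G)) (S : Set β) : Prop :=
  (∀ e ∈ D, e.edge ∈ S) ∧ ∀ b ∈ S, ∃! e : OrientedEdge G, e ∈ D ∧ e.edge = b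

/-- `D` is a coherent acyclic orientation of the spanning subgraph with edge set `S`: for some
ordered partition of the vertex set into non-empty parts, `S` is the edge set of the associated
cut subgraph, and `D` orients all edges from the part of smaller to the part of larger index. -/
def IsCoherentAcyclic {G : Graph α β} (D : Set (OrientedEdge G)) (S : Set β) : Prop :=
  IsOrientation D S ∧ ∃ (s : ℕ) (p : V(G) → Fin s), Function.Surjective p ∧
    S = cutEdges G p ∧ ∀ e : OrientedEdge G, p e.tail < p e.head → e ∈ D

/-- The set `CAC` of coherent acyclic orientations of cut subgraphs of `G`, each regarded as a
set of oriented edges. -/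
@[ext]
structure CAC (G : Graph α β) where
  /-- the set of oriented edges -/
  arrows : Set (OrientedEdge G)
  /-- it is a coherent acyclic orientation of some cut subgraph -/
  isCoherentAcyclic : ∃ S : Set β, IsCoherentAcyclic arrows S

/-- `D₁ ≼ D₂` if the oriented edges of `D₂` are among those of `D₁`. -/
instance (G : Graph α β) : PartialOrder (CAC G) where
  le D₁ D₂ := D₂.arrows ⊆ D₁.arrows
  le_refl _ := subset_rfl
  le_trans _ _ _ h₁ h₂ := h₂.trans h₁
  le_antisymm _ _ h₁ h₂ := CAC.ext (h₂.antisymm h₁)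

/-! ### Bonds and their hyperplanes -/

/-- `b` is a bond element of the cut lattice: `b = d(χ_C)` for a set `C` of vertices such that
`C` and its complement are non-empty and induce connected subgraphs. -/
def IsBond {G : Graph α β} (b : cutSpace G) : Prop :=
  ∃ C : Set V(G), IsConnectedOn G C ∧ IsConnectedOn G Cᶜ ∧ b = toCutSpace G (C.indicator 1)

/-- The positive support of a cochain. -/
def posSupp {G : Graph α β} (x : C1 G ℝ) : Set (OrientedEdge G) := {e | 0 < x.1 e}

/-- The affine hyperplane `F_b = {x ∈ F_ℝ | 2⟨x, b⟩ = ‖b‖²}`. -/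
def bondHyperplane {G : Graph α β} (b : cutSpace G) : Set (cutSpace G) :=
  {x | 2 * pairing (x : C1 G ℝ) (b : C1 G ℝ) = normSq (b : C1 G ℝ)}

end CutVoronoi

namespace CutVoronoi

variable {α β : Type*} {G : Graph α β}

/-! On the polytope, `2⟨x, z⟩ ≤ ‖z‖₁` for every `z` in the cut space (`two_mul_pairing_le`): `z` is
a nonnegative combination of cuts sign-compatible with it, the `ℓ¹`-norm is additive on such a
combination, and for one cut the bound is a Voronoi inequality. Equality is attained at the
orthogonal projection of `sign(z)/2`, which lies in the polytope since `|n| ≤ n²` for integers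
(`exists_mem_face`). Hence every non-empty face is the equality set `face z` of some `z`, and
inclusion of these faces is reverse inclusion of positive supports (`face_subset_face`). The
positive supports are exactly the coherent acyclic orientations: the level sets of a potential form
the ordered partition. The union formula holds because every positive support is a union of positive
supports of bonds (`exists_bond_subset`). -/

lemma finite_orientedEdge [Finite V(G)] [Finite E(G)] : Finite (OrientedEdge G) := by
  refine Finite.of_injective
    (fun e : OrientedEdge G => ((⟨e.edge, e.isLink.edge_mem⟩ : E(G)), e.tail, e.head)) ?_
  intro e e' h
  simp only [Prod.mk.injEq, Subtype.mk.injEq] at h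
  exact OrientedEdge.ext h.1 h.2.1 h.2.2

@[simp] lemma OrientedEdge.rev_head (e : OrientedEdge G) : e.rev.head = e.tail := rfl
@[simp] lemma OrientedEdge.rev_tail (e : OrientedEdge G) : e.rev.tail = e.head := rfl
@[simp] lemma OrientedEdge.rev_rev (e : OrientedEdge G) : e.rev.rev = e := rfl

lemma C1.apply_rev (x : C1 G ℝ) (e : OrientedEdge G) : x.1 e.rev = -x.1 e := x.2 e

lemma toCutSpace_apply (f : V(G) → ℝ) (e : OrientedEdge G) :
    (toCutSpace G f).1.1 e = f e.head - f e.tail := rfl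

lemma exists_toCutSpace_eq (z : cutSpace G) : ∃ f, toCutSpace G f = z :=
  (d G ℝ).surjective_rangeRestrict z

lemma cutSpace_ext {x y : cutSpace G} (h : ∀ e, x.1.1 e = y.1.1 e) : x = y :=
  Subtype.ext (Subtype.ext (funext h))

lemma exists_int_of_mem_cutLattice {μ : cutSpace G} (hμ : μ ∈ cutLattice G) (e : OrientedEdge G) :
    ∃ n : ℤ, μ.1.1 e = n := by
  obtain ⟨f, rfl⟩ := hμ
  exact ⟨f e.head - f e.tail, by push_cast; rfl⟩

/-- Reversing edges carries the hypothesis to the negative entries of `y`, so `t * y e` always lies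
between `0` and `z e`, and no cancellation occurs. -/
lemma conformal_of_pos {y z : C1 G ℝ} {t : ℝ} (h : ∀ e ∈ posSupp y, t * y.1 e ≤ z.1 e)
    (ht : 0 < t) (e : OrientedEdge G) : |z.1 e| = |z.1 e - t * y.1 e| + t * |y.1 e| := by
  rcases lt_trichotomy (y.1 e) 0 with hy | hy | hy
  · have h1 := h e.rev (by simpa [posSupp, C1.apply_rev] using hy)
    rw [C1.apply_rev, C1.apply_rev] at h1
    have h2 : t * y.1 e < 0 := mul_neg_of_pos_of_neg ht hy
    rw [abs_of_neg hy, abs_of_nonpos (by linarith), abs_of_nonpos (by linarith)]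
    ring
  · simp [hy]
  · have h1 := h e hy
    have h2 : 0 < t * y.1 e := mul_pos ht hy
    rw [abs_of_pos hy, abs_of_nonneg (by linarith), abs_of_nonneg (by linarith)]
    ring

/-! ### The scalar product -/

section Finite

variable [Fintype (OrientedEdge G)]

lemma pairing_eq_sum (x y : C1 G ℝ) : pairing x y = 1 / 2 * ∑ e, x.1 e * y.1 e := by
  rw [pairing, finsum_eq_sum_of_fintype]

/-- The scalar product as a bilinear form on the cut space. -/
noncomputable def pairingForm : cutSpace G →ₗ[ℝ] cutSpace G →ₗ[ℝ] ℝ :=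
  LinearMap.mk₂ ℝ (fun x y => pairing x.1 y.1)
    (fun x x' y => by simp [pairing_eq_sum, add_mul, mul_add, Finset.sum_add_distrib])
    (fun c x y => by simp [pairing_eq_sum, Finset.mul_sum]; congr! 1; ring)
    (fun x y y' => by simp [pairing_eq_sum, mul_add, Finset.sum_add_distrib])
    (fun c x y => by simp [pairing_eq_sum, Finset.mul_sum]; congr! 1; ring)

lemma pairingForm_apply (x y : cutSpace G) : pairingForm x y = pairing x.1 y.1 := rfl

lemma pairing_comm (x y : C1 G ℝ) : pairing x y = pairing y x := by
  simp [pairing_eq_sum, mul_comm]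

/-- The pairing is positive definite, so it embeds the finite-dimensional cut space in its dual, and
equal dimensions make this onto. -/
lemma exists_eq_pairing [Finite V(G)] (l : cutSpace G →ₗ[ℝ] ℝ) :
    ∃ y : cutSpace G, ∀ x, l x = pairing y.1 x.1 := by
  have : FiniteDimensional ℝ (cutSpace G) :=
    Module.Finite.of_surjective (toCutSpace G) ((d G ℝ).surjective_rangeRestrict)
  let F : cutSpace G →ₗ[ℝ] Module.Dual ℝ (cutSpace G) := pairingForm
  have hinj : Function.Injective F := by
    rw [injective_iff_map_eq_zero]
    intro x hx
    have h : pairing x.1 x.1 = 0 := by exact LinearMap.congr_fun hx x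
    rw [pairing_eq_sum] at h
    have h2 : ∑ e, x.1.1 e * x.1.1 e = 0 := by linarith
    rw [Finset.sum_eq_zero_iff_of_nonneg fun e _ => mul_self_nonneg _] at h2
    exact cutSpace_ext fun e => by simpa using h2 e (Finset.mem_univ _)
  obtain ⟨y, hy⟩ := (LinearMap.injective_iff_surjective_of_finrank_eq_finrank
    (V := cutSpace G) (V₂ := Module.Dual ℝ (cutSpace G)) (f := F) (Subspace.dual_finrank_eq (K := ℝ) (V := cutSpace G)).symm).1 hinj l
  exact ⟨y, fun x => by rw [← hy]; rfl⟩

/-- The `ℓ¹`-norm: the sum of `|x e|` over the edges, each with one orientation. -/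
noncomputable def normOne (x : C1 G ℝ) : ℝ := 1 / 2 * ∑ e, |x.1 e|

lemma mem_vorCell_zero {x : cutSpace G} :
    x ∈ vorCell G 0 ↔ ∀ μ ∈ cutLattice G, 2 * pairing x.1 μ.1 ≤ normSq μ.1 := by
  refine forall₂_congr fun μ _ => ?_
  have h : normSq (x - μ : cutSpace G).1 = normSq x.1 - 2 * pairing x.1 μ.1 + normSq μ.1 := by
    have h1 (e) : (x - μ : cutSpace G).1.1 e = x.1.1 e - μ.1.1 e := rfl
    simp only [normSq, pairing_eq_sum, h1, Finset.mul_sum, ← Finset.sum_sub_distrib,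
      ← Finset.sum_add_distrib]
    exact Finset.sum_congr rfl fun e _ => by ring
  have h0 : (x - 0 : cutSpace G) = x := sub_zero x
  rw [h0, h]
  constructor <;> intro h <;> linarith

lemma normOne_le_normSq {μ : cutSpace G} (hμ : μ ∈ cutLattice G) : normOne μ.1 ≤ normSq μ.1 := by
  rw [normOne, normSq, pairing_eq_sum]
  gcongr with e
  obtain ⟨n, hn⟩ := exists_int_of_mem_cutLattice hμ e
  rw [hn, ← abs_mul_abs_self (n : ℝ)]
  rcases eq_or_ne n 0 with rfl | h0
  · simp
  · have : (1 : ℝ) ≤ |(n : ℝ)| := by exact_mod_cast Int.one_le_abs h0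
    nlinarith

end Finite

/-! ### Cuts -/

/-- The oriented edges that enter `C`. -/
def cutArrows (C : Set V(G)) : Set (OrientedEdge G) := {e | e.head ∈ C ∧ e.tail ∉ C}

/-- The element `d(χ_C)` of the cut lattice. -/
noncomputable def cutElement (C : Set V(G)) : cutSpace G := toCutSpace G (C.indicator 1)

lemma cutElement_mem (C : Set V(G)) : cutElement C ∈ cutLattice G := by
  classical
  refine ⟨C.indicator 1, ?_⟩
  change toCutSpace G _ = toCutSpace G _
  congr 1
  ext v
  by_cases h : v ∈ C <;> simp [h]

lemma cutElement_of_mem {C : Set V(G)} {e : OrientedEdge G} (he : e ∈ cutArrows C) :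
    (cutElement C).1.1 e = 1 := by
  simp [cutElement, toCutSpace_apply, he.1, he.2]

lemma cutElement_cases (C : Set V(G)) (e : OrientedEdge G) :
    e ∈ cutArrows C ∨ e.rev ∈ cutArrows C ∨ (cutElement C).1.1 e = 0 := by
  by_cases h : e.head ∈ C <;> by_cases h' : e.tail ∈ C <;>
    simp [cutElement, toCutSpace_apply, cutArrows, h, h']

lemma posSupp_cutElement (C : Set V(G)) : posSupp (cutElement C).1 = cutArrows C := by
  ext e
  refine ⟨fun he => ?_, fun he => ?_⟩
  · rcases cutElement_cases C e with h | h | h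
    · exact h
    · have h1 := cutElement_of_mem h
      rw [C1.apply_rev] at h1
      have : 0 < (cutElement C).1.1 e := he
      linarith
    · exact absurd h (ne_of_gt he)
  · change 0 < (cutElement C).1.1 e
    rw [cutElement_of_mem he]
    exact one_pos

lemma normSq_cutElement [Fintype (OrientedEdge G)] (C : Set V(G)) :
    normSq (cutElement C).1 = normOne (cutElement C).1 := by
  rw [normSq, pairing_eq_sum, normOne]
  congr! 2 with e
  rcases cutElement_cases C e with h | h | h
  · simp [cutElement_of_mem h]
  · have h1 := cutElement_of_mem h
    rw [C1.apply_rev, neg_eq_iff_eq_neg] at h1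
    simp [h1]
  · simp [h]

/-! ### Bonds as minimal cuts -/

lemma exists_mem_cutArrows [G.Loopless] (hG : IsConnected G) {A : Set V(G)} (hA : A.Nonempty)
    (hA' : Aᶜ.Nonempty) : (cutArrows A).Nonempty := by
  obtain ⟨u, hu⟩ := hA
  obtain ⟨v, hv⟩ := hA'
  obtain ⟨p⟩ := hG.preconnected u v
  obtain ⟨a, -, h1, h2⟩ := p.exists_boundary_dart A hu hv
  obtain ⟨e, he⟩ := (Graph.toSimpleGraph_adj_iff _ _).1 a.adj
  exact ⟨⟨e, a.snd, a.fst, he.symm⟩, h1, h2⟩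

lemma exists_split [G.Loopless] {C : Set V(G)} (hC : C.Nonempty) (h : ¬ IsConnectedOn G C) :
    ∃ A ⊆ C, A.Nonempty ∧ (C \ A).Nonempty ∧
      ∀ e : OrientedEdge G, e.tail ∈ A → e.head ∈ C → e.head ∈ A := by
  have : Nonempty C := hC.to_subtype
  have h' : ¬ (G.toSimpleGraph.induce C).Preconnected := fun hp => h ⟨hp⟩
  simp only [SimpleGraph.Preconnected, not_forall] at h'
  obtain ⟨u, v, huv⟩ := h'
  refine ⟨{w | ∃ hw : w ∈ C, (G.toSimpleGraph.induce C).Reachable u ⟨w, hw⟩}, fun w hw => hw.1,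
    ⟨u, u.2, .rfl⟩, ⟨v, v.2, fun hv => huv hv.2⟩, ?_⟩
  rintro e ⟨ht, hr⟩ hh
  refine ⟨hh, hr.trans (SimpleGraph.Adj.reachable ?_)⟩
  exact (Graph.toSimpleGraph_adj_iff _ _).2 e.isLink.adj

/-- If `C` split into two pieces with no edge between them, its cut would be the disjoint union of
their cuts, both non-empty as `G` is connected. The piece containing the head of `e` would then
contradict minimality. -/
lemma isConnectedOn_of_minimal [G.Loopless] (hG : IsConnected G) {C : Set V(G)}
    {e : OrientedEdge G} (he : e ∈ cutArrows C)
    (hmin : ∀ C', e ∈ cutArrows C' → cutArrows C' ⊆ cutArrows C → cutArrows C ⊆ cutArrows C') :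
    IsConnectedOn G C := by
  by_contra h
  obtain ⟨A, hAC, hA, hA', hsplit⟩ := exists_split ⟨_, he.1⟩ h
  have hsub : cutArrows A ⊆ cutArrows C := fun a ha =>
    ⟨hAC ha.1, fun ht => ha.2 (hsplit a.rev ha.1 ht)⟩
  have hsub' : cutArrows (C \ A) ⊆ cutArrows C := fun a ha =>
    ⟨ha.1.1, fun ht => ha.2 ⟨ht, fun htA => ha.1.2 (hsplit a htA ha.1.1)⟩⟩
  by_cases heA : e.head ∈ A
  · obtain ⟨a, ha⟩ := exists_mem_cutArrows hG hA' ⟨e.tail, fun h => he.2 h.1⟩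
    exact ha.1.2 (hmin A ⟨heA, fun h => he.2 (hAC h)⟩ hsub (hsub' ha)).1
  · obtain ⟨a, ha⟩ := exists_mem_cutArrows hG hA ⟨e.tail, fun h => he.2 (hAC h)⟩
    exact (hmin (C \ A) ⟨⟨he.1, heA⟩, fun h => he.2 h.1⟩ hsub' (hsub ha)).1.2 ha.1

lemma rev_mem_cutArrows_compl {C : Set V(G)} {e : OrientedEdge G} :
    e.rev ∈ cutArrows Cᶜ ↔ e ∈ cutArrows C := by
  simp [cutArrows, and_comm]

lemma mem_cutArrows_compl {C : Set V(G)} {e : OrientedEdge G} :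
    e ∈ cutArrows Cᶜ ↔ e.rev ∈ cutArrows C := by
  simp [cutArrows, and_comm]

lemma exists_cutArrows_subset {z : cutSpace G} {e : OrientedEdge G} (he : e ∈ posSupp z.1) :
    ∃ C : Set V(G), e ∈ cutArrows C ∧ cutArrows C ⊆ posSupp z.1 := by
  obtain ⟨f, rfl⟩ := exists_toCutSpace_eq z
  simp only [posSupp, toCutSpace_apply, Set.mem_ofPred_eq, sub_pos] at he ⊢
  -- Every arrow entering a superlevel set of the potential goes uphill.
  refine ⟨{v | f e.head ≤ f v}, ⟨le_refl (f e.head), not_le.2 he⟩, fun a ha => ?_⟩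
  exact lt_of_lt_of_le (not_le.1 ha.2) (show f e.head ≤ f a.head from ha.1)

lemma exists_bond_subset [G.Loopless] [Finite (OrientedEdge G)] (hG : IsConnected G)
    {z : cutSpace G} {e : OrientedEdge G} (he : e ∈ posSupp z.1) :
    ∃ b : cutSpace G, IsBond b ∧ e ∈ posSupp b.1 ∧ posSupp b.1 ⊆ posSupp z.1 := by
  obtain ⟨C₀, h₀⟩ := exists_cutArrows_subset he
  obtain ⟨D, ⟨⟨C, rfl⟩, heC, hC⟩, hmin⟩ := Set.Finite.exists_minimal
    (s := {D | (∃ C : Set V(G), cutArrows C = D) ∧ e ∈ D ∧ D ⊆ posSupp z.1}) (Set.toFinite _)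
    ⟨_, ⟨C₀, rfl⟩, h₀⟩
  have key (C' : Set V(G)) (h1 : e ∈ cutArrows C') (h2 : cutArrows C' ⊆ cutArrows C) :
      cutArrows C ⊆ cutArrows C' := hmin ⟨⟨C', rfl⟩, h1, h2.trans hC⟩ h2
  refine ⟨cutElement C, ⟨C, isConnectedOn_of_minimal hG heC key, ?_, rfl⟩, ?_⟩
  -- Reversal exchanges the cuts of `C` and `Cᶜ`, so minimality passes to the complement.
  · refine isConnectedOn_of_minimal hG (rev_mem_cutArrows_compl.2 heC) fun C' h1 h2 a ha => ?_
    have h3 := key C'ᶜ (mem_cutArrows_compl.2 h1) fun a ha =>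
      rev_mem_cutArrows_compl.1 (h2 (mem_cutArrows_compl.1 ha))
    simpa using mem_cutArrows_compl.1 (h3 (mem_cutArrows_compl.1 ha))
  · rw [posSupp_cutElement]
    exact ⟨heC, hC⟩

/-! ### The faces of the cut Voronoi polytope -/

section Finite

variable [Fintype (OrientedEdge G)]

lemma normOne_eq_add {y z : cutSpace G} {t : ℝ} (h : ∀ e ∈ posSupp y.1, t * y.1.1 e ≤ z.1.1 e)
    (ht : 0 < t) : normOne z.1 = normOne (z - t • y : cutSpace G).1 + t * normOne y.1 := by
  have h1 : ∑ e, |z.1.1 e| = ∑ e, |z.1.1 e - t * y.1.1 e| + t * ∑ e, |y.1.1 e| := by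
    rw [Finset.mul_sum, ← Finset.sum_add_distrib]
    exact Finset.sum_congr rfl fun e _ => conformal_of_pos h ht e
  have h2 : normOne (z - t • y : cutSpace G).1 = 1 / 2 * ∑ e, |z.1.1 e - t * y.1.1 e| := rfl
  rw [h2, normOne, normOne, h1]
  ring

lemma pairing_eq_add (x y z : cutSpace G) (t : ℝ) :
    pairing x.1 z.1 = pairing x.1 (z - t • y : cutSpace G).1 + t * pairing x.1 y.1 := by
  have h (e) : (z - t • y : cutSpace G).1.1 e = z.1.1 e - t * y.1.1 e := rfl
  simp only [pairing_eq_sum, h, Finset.mul_sum, ← Finset.sum_add_distrib]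
  exact Finset.sum_congr rfl fun e _ => by ring

/-- On the cut Voronoi polytope, the support function is half the `ℓ¹`-norm. -/
lemma two_mul_pairing_le {x : cutSpace G} (hx : x ∈ vorCell G 0) (z : cutSpace G) :
    2 * pairing x.1 z.1 ≤ normOne z.1 := by
  classical
  induction hn : (posSupp z.1).ncard using Nat.strong_induction_on generalizing z with
  | _ n ih =>
    subst hn
    rcases (posSupp z.1).eq_empty_or_nonempty with h0 | ⟨e, he⟩
    · have hz : z = 0 := by
        refine cutSpace_ext fun e => ?_
        have h1 : e ∉ posSupp z.1 := by simp [h0]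
        have h2 : e.rev ∉ posSupp z.1 := by simp [h0]
        simp only [posSupp, Set.mem_ofPred_eq, C1.apply_rev] at h1 h2
        change z.1.1 e = 0
        linarith
      simp [hz, pairing_eq_sum, normOne]
    · obtain ⟨C, heC, hC⟩ := exists_cutArrows_subset he
      -- Subtracting the smallest value of `z` on the cut keeps signs compatible and kills the arrow
      -- `a`, so the positive support strictly shrinks.
      obtain ⟨a, haC, ha⟩ := Set.exists_min_image (cutArrows C) (fun e => z.1.1 e)
        (Set.toFinite _) ⟨e, heC⟩
      set t := z.1.1 a with ht_def
      have ht : 0 < t := hC haC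
      have hle : ∀ e ∈ posSupp (cutElement C).1, t * (cutElement C).1.1 e ≤ z.1.1 e := by
        intro e he
        rw [posSupp_cutElement] at he
        rw [cutElement_of_mem he, mul_one]
        exact ha e he
      have hval (e : OrientedEdge G) : (z - t • cutElement C : cutSpace G).1.1 e =
        z.1.1 e - t * (cutElement C).1.1 e := rfl
      have hlt : (posSupp (z - t • cutElement C : cutSpace G).1).ncard < (posSupp z.1).ncard := by
        refine Set.ncard_lt_ncard (Set.ssubset_iff_of_subset ?_ |>.2 ⟨a, hC haC, ?_⟩)
          (Set.toFinite _)
        · intro e he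
          by_contra hne
          have h1 : 0 < (z - t • cutElement C : cutSpace G).1.1 e := he
          have h2 : ¬ 0 < z.1.1 e := hne
          have h3 := conformal_of_pos hle ht e
          rw [hval] at h1
          rw [abs_of_pos h1, abs_of_nonpos (not_lt.1 h2)] at h3
          have h4 := mul_le_mul_of_nonneg_left (neg_le_abs ((cutElement C).1.1 e)) ht.le
          linarith
        · simp [posSupp, cutElement_of_mem haC, ht_def]
      have h1 := ih _ hlt (z - t • cutElement C) rfl
      have h2 := mem_vorCell_zero.1 hx _ (cutElement_mem C)
      rw [normSq_cutElement] at h2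
      rw [pairing_eq_add x (cutElement C) z t, normOne_eq_add hle ht]
      nlinarith

/-- The set of points of the cut Voronoi polytope at which `⟨·, z⟩` is maximal. -/
def face (z : cutSpace G) : Set (cutSpace G) :=
  {x ∈ vorCell G 0 | 2 * pairing x.1 z.1 = normOne z.1}

lemma sign_mul_le_abs (a b : ℝ) : SignType.sign a * b ≤ |b| := by
  rcases lt_trichotomy a 0 with h | h | h
  · simp [h, neg_le_abs]
  · simp [h]
  · simp [h, le_abs_self]

/-- A point in the relative interior of `face z`. -/
lemma exists_mem_face [Finite V(G)] (z : cutSpace G) :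
    ∃ x ∈ face z, ∀ y, x ∈ face y → posSupp y.1 ⊆ posSupp z.1 := by
  -- `1/4` is the factor `1/2` of the pairing times that of `sign(z)/2`; the vector representing `l`
  -- is the projection of `sign(z)/2` to the cut space.
  let l : cutSpace G →ₗ[ℝ] ℝ :=
    { toFun := fun y => 1 / 4 * ∑ e, (SignType.sign (z.1.1 e) : ℝ) * y.1.1 e
      map_add' := fun x y => by simp [mul_add, Finset.sum_add_distrib]
      map_smul' := fun c x => by simp [Finset.mul_sum]; congr! 1; ring }
  obtain ⟨x, hx⟩ := exists_eq_pairing l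
  have hx' (y : cutSpace G) :
      2 * pairing x.1 y.1 = 1 / 2 * ∑ e, (SignType.sign (z.1.1 e) : ℝ) * y.1.1 e := by
    rw [← hx]
    simp only [l, LinearMap.coe_mk, AddHom.coe_mk]
    ring
  refine ⟨x, ⟨mem_vorCell_zero.2 fun μ hμ => le_trans ?_ (normOne_le_normSq hμ), ?_⟩, ?_⟩
  · rw [hx', normOne]
    gcongr
    exact sign_mul_le_abs _ _
  · rw [hx', normOne]
    simp [sign_mul_self]
  · intro y hy e he
    have h1 := hy.2
    rw [hx', normOne, mul_right_inj' (by norm_num),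
      Finset.sum_eq_sum_iff_of_le fun e _ => sign_mul_le_abs _ _] at h1
    have h2 := h1 e (Finset.mem_univ _)
    have he' : 0 < y.1.1 e := he
    rw [abs_of_pos he'] at h2
    by_contra hne
    rcases (not_lt.1 hne : z.1.1 e ≤ 0).lt_or_eq with h | h
    · simp only [h, sign_neg, SignType.coe_neg_one] at h2
      linarith
    · simp only [h, sign_zero, SignType.coe_zero] at h2
      linarith

/-- One direction tests the inclusion at a relative interior point. For the other, `z = (z - t y) +
t y` without cancellation for small `t > 0`, so equality for `z` forces equality for both summands.
-/
lemma face_subset_face [Finite V(G)] {y z : cutSpace G} :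
    face z ⊆ face y ↔ posSupp y.1 ⊆ posSupp z.1 := by
  constructor
  · intro h
    obtain ⟨x, hx, hx'⟩ := exists_mem_face z
    exact hx' y (h hx)
  · rintro h x ⟨hx, hxz⟩
    refine ⟨hx, (two_mul_pairing_le hx y).antisymm ?_⟩
    obtain ⟨t, ht, hle⟩ : ∃ t : ℝ, 0 < t ∧ ∀ e ∈ posSupp y.1, t * y.1.1 e ≤ z.1.1 e := by
      have : ∀ᶠ t : ℝ in nhdsWithin 0 (Set.Ioi 0), ∀ e, e ∈ posSupp y.1 →
          t * y.1.1 e ≤ z.1.1 e := by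
        refine Filter.eventually_all.2 fun e => ?_
        by_cases he : e ∈ posSupp y.1
        · have hc : Filter.Tendsto (fun t : ℝ => t * y.1.1 e) (nhds 0) (nhds 0) :=
            Continuous.tendsto' (by fun_prop) _ _ (by simp)
          filter_upwards [(hc.eventually_lt_const (h he : 0 < z.1.1 e)).filter_mono
            nhdsWithin_le_nhds] with t ht _ using ht.le
        · exact .of_forall fun t h => absurd h he
      obtain ⟨t, h1, h2⟩ := (this.and self_mem_nhdsWithin).exists
      exact ⟨t, h2, h1⟩
    have h1 := two_mul_pairing_le hx (z - t • y)
    rw [pairing_eq_add x y z t, normOne_eq_add hle ht] at hxz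
    by_contra hlt
    have := mul_lt_mul_of_pos_left (not_le.1 hlt) ht
    linarith

/-- A cut has entries `0, ±1`, so its squared norm is its `ℓ¹`-norm and its hyperplane meets the
polytope in its face. -/
lemma face_subset_bondHyperplane [Finite V(G)] {b z : cutSpace G} (hb : IsBond b) :
    face z ⊆ bondHyperplane b ↔ posSupp b.1 ⊆ posSupp z.1 := by
  obtain ⟨C, -, -, rfl⟩ := hb
  change _ ⊆ bondHyperplane (cutElement C) ↔ posSupp (cutElement C).1 ⊆ _
  rw [← face_subset_face]
  simp only [bondHyperplane, normSq_cutElement]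
  exact ⟨fun h x hx => ⟨hx.1, h hx⟩, fun h x hx => (h hx).2⟩

lemma face_eq_argmax [Finite V(G)] (z : cutSpace G) :
    face z = {x ∈ vorCell G 0 | ∀ y ∈ vorCell G 0, pairing y.1 z.1 ≤ pairing x.1 z.1} := by
  ext x
  refine and_congr_right fun hx => ⟨fun h y hy => ?_, fun h => ?_⟩
  · have := two_mul_pairing_le hy z
    linarith
  · obtain ⟨y, hy, -⟩ := exists_mem_face z
    have h1 := h y hy.1
    have h2 := two_mul_pairing_le hx z
    have h3 := hy.2
    linarith

lemma isExposed_face [Finite V(G)] (z : cutSpace G) : IsExposed ℝ (vorCell G 0) (face z) := by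
  have : FiniteDimensional ℝ (cutSpace G) :=
    Module.Finite.of_surjective (toCutSpace G) ((d G ℝ).surjective_rangeRestrict)
  intro _
  refine ⟨LinearMap.toContinuousLinearMap (E := cutSpace G) (pairingForm z), ?_⟩
  rw [face_eq_argmax]
  simp [pairingForm_apply, pairing_comm]

lemma exists_eq_face [Finite V(G)] (f : FacePoset G) : ∃ z, f.1 = face z := by
  obtain ⟨l, hl⟩ := f.2.1 f.2.2
  obtain ⟨z, hz⟩ := exists_eq_pairing (G := G) l.toLinearMap
  refine ⟨z, ?_⟩
  rw [hl, face_eq_argmax]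
  have hz' (x : cutSpace G) : l x = pairing x.1 z.1 := (hz x).trans (pairing_comm _ _)
  simp [hz']

end Finite

/-! ### Coherent acyclic orientations as positive supports -/

lemma isOrientation_of_lt {s : ℕ} (p : V(G) → Fin s) :
    IsOrientation {e : OrientedEdge G | p e.tail < p e.head} (cutEdges G p) := by
  refine ⟨fun e he => ⟨_, _, e.isLink, ne_of_lt he⟩, ?_⟩
  rintro b ⟨u, v, h, hne⟩
  wlog hlt : p u < p v generalizing u v
  · exact this v u h.symm hne.symm (lt_of_le_of_ne (not_lt.1 hlt) hne.symm)
  refine ⟨⟨b, u, v, h⟩, ⟨hlt, rfl⟩, ?_⟩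
  rintro ⟨b', u', v', h'⟩ ⟨hlt', rfl⟩
  rcases h'.eq_and_eq_or_eq_and_eq h with ⟨h1, h2⟩ | ⟨h1, h2⟩
  · exact OrientedEdge.ext rfl (Subtype.ext h1) (Subtype.ext h2)
  · have h1 : u' = v := Subtype.ext h1
    have h2 : v' = u := Subtype.ext h2
    subst h1 h2
    exact absurd hlt hlt'.asymm

lemma CAC.exists_arrows_eq (D : CAC G) : ∃ z : cutSpace G, D.arrows = posSupp z.1 := by
  obtain ⟨S, hor, s, p, -, rfl, hp⟩ := D.isCoherentAcyclic
  refine ⟨toCutSpace G fun v => (p v : ℕ), ?_⟩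
  ext e
  have hpos : e ∈ posSupp (toCutSpace G fun v => ((p v : ℕ) : ℝ)).1 ↔ p e.tail < p e.head := by
    simp [posSupp, toCutSpace_apply]
  rw [hpos]
  refine ⟨fun he => ?_, hp e⟩
  have hb := hor.1 e he
  obtain ⟨a, ha, hu⟩ := hor.2 _ hb
  have hae := hu e ⟨he, rfl⟩
  by_contra hlt
  obtain ⟨u, v, h, hne⟩ := hb
  have hne' : p e.tail ≠ p e.head := by
    rcases e.isLink.eq_and_eq_or_eq_and_eq h with ⟨h1, h2⟩ | ⟨h1, h2⟩
    · rwa [Subtype.ext h1, Subtype.ext h2]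
    · rw [Subtype.ext h1, Subtype.ext h2]
      exact hne.symm
  -- An arrow of `D` not going up would have its reverse in `D` too, against uniqueness of the
  -- orientation.
  have hrev : e.rev = e :=
    (hu e.rev ⟨hp e.rev (lt_of_le_of_ne (not_lt.1 hlt) hne'.symm), rfl⟩).trans hae.symm
  exact hne' (by rw [← e.rev_head, hrev])

lemma exists_CAC_eq [Finite V(G)] (z : cutSpace G) : ∃ D : CAC G, D.arrows = posSupp z.1 := by
  classical
  have := Fintype.ofFinite V(G)
  obtain ⟨f, rfl⟩ := exists_toCutSpace_eq z
  -- Ranking only the values taken by `f` leaves no part empty.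
  let o := (Finset.univ.image f).orderIsoOfFin rfl
  let p (v : V(G)) := o.symm ⟨f v, Finset.mem_image_of_mem f (Finset.mem_univ v)⟩
  have hp (u v : V(G)) : p u < p v ↔ f u < f v := by simp [p]
  have hset : posSupp (toCutSpace G f).1 = {e | p e.tail < p e.head} := by
    ext e
    simp [posSupp, toCutSpace_apply, hp]
  refine ⟨⟨posSupp (toCutSpace G f).1, cutEdges G p, ?_, _, p, ?_, rfl, ?_⟩, rfl⟩
  · rw [hset]
    exact isOrientation_of_lt p
  · intro i
    obtain ⟨v, -, hv⟩ := Finset.mem_image.1 (o i).2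
    exact ⟨v, by simp [p, hv]⟩
  · rw [hset]
    exact fun e he => he

end CutVoronoi

/-! ### The isomorphism of posets -/

open CutVoronoi in
theorem theoremA {α β : Type*} (G : Graph α β) [Finite V(G)] [Finite E(G)] [G.Loopless]
    (hG : CutVoronoi.IsConnected G) :
    ∃ φ : CutVoronoi.FacePoset G ≃o CutVoronoi.CAC G,
      ∀ f : CutVoronoi.FacePoset G,
        (φ f).arrows =
          ⋃ b ∈ {b : CutVoronoi.cutSpace G |
              CutVoronoi.IsBond b ∧ f.1 ⊆ CutVoronoi.bondHyperplane b},
            CutVoronoi.posSupp (b : CutVoronoi.C1 G ℝ) := by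
  have := finite_orientedEdge (G := G)
  have := Fintype.ofFinite (OrientedEdge G)
  choose z hz using CAC.exists_arrows_eq (G := G)
  let ψ (D : CAC G) : FacePoset G :=
    ⟨face (z D), isExposed_face _, (exists_mem_face (z D)).imp fun _ h => h.1⟩
  have hψ (D D' : CAC G) : ψ D ≤ ψ D' ↔ D ≤ D' := by
    change face (z D) ⊆ face (z D') ↔ D'.arrows ⊆ D.arrows
    rw [face_subset_face, hz, hz]
  have hsurj : Function.Surjective ψ := by
    intro f
    obtain ⟨y, hy⟩ := exists_eq_face f
    obtain ⟨D, hD⟩ := exists_CAC_eq y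
    refine ⟨D, Subtype.ext ?_⟩
    rw [hz] at hD
    rw [hy]
    exact (face_subset_face.2 hD.ge).antisymm (face_subset_face.2 hD.le)
  let Ψ : CAC G ≃o FacePoset G :=
    RelIso.ofSurjective (OrderEmbedding.ofMapLEIff ψ hψ) hsurj
  refine ⟨Ψ.symm, fun f => ?_⟩
  obtain ⟨D, rfl⟩ := Ψ.surjective f
  rw [OrderIso.symm_apply_apply, hz]
  change _ = ⋃ b ∈ {b : cutSpace G | IsBond b ∧ face (z D) ⊆ bondHyperplane b}, posSupp b.1
  ext e
  simp only [Set.mem_iUnion, Set.mem_ofPred_eq, exists_prop]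
  constructor
  · intro he
    obtain ⟨b, hb, heb, hbz⟩ := exists_bond_subset hG he
    exact ⟨b, ⟨hb, (face_subset_bondHyperplane hb).2 hbz⟩, heb⟩
  · rintro ⟨b, ⟨hb, hbz⟩, heb⟩
    exact (face_subset_bondHyperplane hb).1 hbz heb
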